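/- Let $V$ be a finite-dimensional real vector space with inner product $(\cdot|\cdot)$ and let $J:V\to V$ be an orthogonal complex structure: $J$ is linear, $J^2=-1$ and $(Jx|Jy)=(x|y)$. Let $V_J$ be $V$ as a complex vector space via $J$, with the complex inner product $\langle x|y\rangle_J=(x|y)+i(Jx|y)$, and let $M=\dim_{\mathbb C}V_J$. Let $V_{\mathbb C}$ be the complexification of $V$, let $(\cdot|\cdot)$ denote also the complex-bilinear extension of the inner product to $V_{\mathbb C}$, and let $C(V_{\mathbb C})$ be the complex Clifford algebra with relations $z^2=(z|z)\mathbf 1$, $z\in V_{\mathbb C}$. Let $V_J^{\pm}\subseteq V_{\mathbb C}$ be the $\pm i$-eigenspaces of $J_{\mathbb C}$; these are isotropic, so that $\bigwedge(V_J^\pm)=C(V_J^\pm)\subseteq C(V_{\mathbb C})$. Put $\gamma^{\pm}(v)=(v\mp iJv)/\sqrt2\in V_J^\pm$ for $v\in V_J$; extend $\gamma^+$ to an algebra isomorphism $\bigwedge(V_J)\to\bigwedge(V_J^+)$ and $\gamma^-$ to a conjugate-linear anti-isomorphism of algebras $\bigwedge(V_J)\to\bigwedge(V_J^-)$. (i)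 There is a unique linear functional $\mathbb E:\bigwedge(V_{\mathbb C})\to\mathbb C$ (the Berezin expectation) such that, for every unitary basis $v_1,\dots,v_M$ of $V_J$ and every $\zeta\in\bigwedge(V_{\mathbb C})$, $\mathbb P(\zeta\wedge e^{-\gamma})=\mathbb E(\zeta)\,\omega$, where $\gamma=\sum_{m=1}^M\gamma^+(v_m)\wedge\gamma^-(v_m)$, $\omega=\frac1{M!}(-\gamma)^M$, and $\mathbb P$ is the orthogonal projection of $\bigwedge(V_{\mathbb C})$ onto $\bigwedge^{2M}(V_{\mathbb C})$, that is, the projection that annihilates the exterior powers of degree $\neq 2M$. (ii) There is a unique linear functional $\tau:C(V_{\mathbb C})\to\mathbb C$ (the Clifford trace) with $\tau(\mathbf 1)=1$, $\tau\circ\Gamma=\tau$ for the automorphism $\Gamma$ that is $-1$ on $V_{\mathbb C}$, and $\tau(ab)=\tau(ba)$ for all $a,b\in C(V_{\mathbb C})$. (iii) There is a unique linear isomorphism $\nu=\nu_J:\bigwedge(V_{\mathbb C})\to C(V_{\mathbb C})$ such that $\nu(\gamma^-(\xi)\wedge\gamma^+(\eta))=\gamma^-(\xi)\gamma^+(\eta)$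 (Clifford product) for all $\xi,\eta\in\bigwedge(V_J)$. (iv) These satisfy $\mathbb E=\tau\circ\nu$. -/

import Mathlib

open scoped TensorProduct ComplexConjugate

noncomputable section

namespace BerezinClifford

universe u

/-- An orthogonal complex structure on a real inner product space. -/
structure OrthogonalComplexStructure (V : Type u) [NormedAddCommGroup V]
    [InnerProductSpace ℝ V] where
  /-- the underlying real-linear map -/
  toLin : V →ₗ[ℝ] V
  apply_apply : ∀ v, toLin (toLin v) = -v
  inner_map_map : ∀ v w, inner ℝ (toLin v) (toLin w) = inner ℝ v w

variable {V : Type u} [NormedAddCommGroup V] [InnerProductSpace ℝ V]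

theorem OrthogonalComplexStructure.inner_left (J : OrthogonalComplexStructure V) (v w : V) :
    inner ℝ (J.toLin v) w = -inner ℝ v (J.toLin w) := by
  rw [← J.inner_map_map (J.toLin v) w, J.apply_apply, inner_neg_left]

theorem OrthogonalComplexStructure.inner_self (J : OrthogonalComplexStructure V) (v : V) :
    inner ℝ (J.toLin v) v = 0 := by
  have h := J.inner_left v v
  rw [real_inner_comm] at h ⊢
  linarith

/-! ### The complex inner product space `V_J` -/

/-- `V_J`: the space `V`, regarded as a complex vector space by means of `J`. -/
@[nolint unusedArguments]
def VJ (_J : OrthogonalComplexStructure V) : Type u := V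

namespace VJ

variable (J : OrthogonalComplexStructure V)

instance : NormedAddCommGroup (VJ J) := inferInstanceAs (NormedAddCommGroup V)

/-- The identity map from `V_J` to `V`. -/
def toV : VJ J ≃+ V := AddEquiv.refl V

/-- `(a + b i) • v = a v + b J v`. -/
instance : Module ℂ (VJ J) where
  smul c v := (toV J).symm (c.re • toV J v + c.im • J.toLin (toV J v))
  one_smul v := by
    change (1 : ℂ).re • toV J v + (1 : ℂ).im • J.toLin (toV J v) = toV J v
    simp
  mul_smul c d v := by
    change (c * d).re • toV J v + (c * d).im • J.toLin (toV J v)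
      = c.re • (d.re • toV J v + d.im • J.toLin (toV J v))
        + c.im • J.toLin (d.re • toV J v + d.im • J.toLin (toV J v))
    simp only [map_add, map_smul, J.apply_apply, Complex.mul_re, Complex.mul_im]
    module
  smul_zero c := by
    change c.re • (0 : V) + c.im • J.toLin (0 : V) = 0
    simp
  smul_add c v w := by
    change c.re • (toV J v + toV J w) + c.im • J.toLin (toV J v + toV J w)
      = (c.re • toV J v + c.im • J.toLin (toV J v))
        + (c.re • toV J w + c.im • J.toLin (toV J w))
    simp only [map_add]
    module
  add_smul c d v := by
    change (c + d).re • toV J v + (c + d).im • J.toLin (toV J v)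
      = (c.re • toV J v + c.im • J.toLin (toV J v))
        + (d.re • toV J v + d.im • J.toLin (toV J v))
    simp only [Complex.add_re, Complex.add_im]
    module
  zero_smul v := by
    change (0 : ℂ).re • toV J v + (0 : ℂ).im • J.toLin (toV J v) = 0
    simp

theorem toV_smul (c : ℂ) (v : VJ J) :
    toV J (c • v) = c.re • toV J v + c.im • J.toLin (toV J v) := rfl

/-- The complex inner product `⟨x | y⟩_J = (x | y) + i (J x | y)`. -/
instance : Inner ℂ (VJ J) where
  inner x y := ⟨inner ℝ (toV J x) (toV J y), inner ℝ (J.toLin (toV J x)) (toV J y)⟩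

theorem inner_def (x y : VJ J) :
    inner ℂ x y = ⟨inner ℝ (toV J x) (toV J y), inner ℝ (J.toLin (toV J x)) (toV J y)⟩ := rfl

theorem norm_toV (x : VJ J) : ‖toV J x‖ = ‖x‖ := rfl

instance : InnerProductSpace ℂ (VJ J) where
  norm_smul_le c v := by
    have h : ‖c • v‖ ^ 2 = (‖c‖ * ‖v‖) ^ 2 := by
      rw [mul_pow, Complex.sq_norm, Complex.normSq_apply, ← norm_toV, ← norm_toV J v, toV_smul,
        ← real_inner_self_eq_norm_sq, ← real_inner_self_eq_norm_sq]
      simp only [inner_add_left, inner_add_right, real_inner_smul_left, real_inner_smul_right,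
        J.inner_map_map, J.inner_self, real_inner_comm (J.toLin (toV J v)) (toV J v)]
      ring
    exact le_of_eq ((sq_eq_sq₀ (norm_nonneg _) (by positivity)).1 h)
  norm_sq_eq_re_inner v := (real_inner_self_eq_norm_sq (toV J v)).symm
  conj_inner_symm x y := by
    simp only [inner_def]
    apply Complex.ext
    · simp [real_inner_comm]
    · simp only [Complex.conj_im]
      rw [J.inner_left (toV J x), real_inner_comm]
  add_left x y z := by
    simp only [inner_def, map_add, inner_add_left]
    rfl
  smul_left x y c := by
    simp only [inner_def, toV_smul, map_add, map_smul, J.apply_apply]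
    apply Complex.ext
    · simp [inner_add_left, real_inner_smul_left]
    · simp [inner_add_left, real_inner_smul_left]

end VJ

/-! ### The complexification, its bilinear form and its Clifford algebra -/

/-- The complexification `V_ℂ`. -/
abbrev VC (V : Type u) [NormedAddCommGroup V] [InnerProductSpace ℝ V] : Type u := ℂ ⊗[ℝ] V

/-- The complex-bilinear extension `(· | ·)` of the inner product to `V_ℂ`. -/
def bilinC (V : Type u) [NormedAddCommGroup V] [InnerProductSpace ℝ V] :
    LinearMap.BilinForm ℂ (VC V) :=
  LinearMap.BilinForm.baseChange ℂ (innerₗ V)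

/-- The quadratic form `z ↦ (z | z)` on `V_ℂ`. -/
def quadC (V : Type u) [NormedAddCommGroup V] [InnerProductSpace ℝ V] :
    QuadraticForm ℂ (VC V) :=
  LinearMap.BilinMap.toQuadraticMap (bilinC V)

/-- The complex Clifford algebra `C(V_ℂ)`, with the relations `z² = (z | z) 1`. -/
abbrev Cl (V : Type u) [NormedAddCommGroup V] [InnerProductSpace ℝ V] : Type u :=
  CliffordAlgebra (quadC V)

/-- The exterior algebra `⋀(V_ℂ)`. -/
abbrev Ext (V : Type u) [NormedAddCommGroup V] [InnerProductSpace ℝ V] : Type u :=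
  ExteriorAlgebra ℂ (VC V)

/-- `τ` is a Clifford trace: a linear functional that is normalized, invariant under the grading
automorphism `Γ` (which is minus the identity on `V_ℂ`), and tracial. -/
structure IsCliffordTrace (τ : Cl V →ₗ[ℂ] ℂ) : Prop where
  map_one : τ 1 = 1
  map_involute : ∀ a, τ (CliffordAlgebra.involute a) = τ a
  map_mul_comm : ∀ a b, τ (a * b) = τ (b * a)

/-! ### The eigenspaces of `J_ℂ` and the maps `γ⁺`, `γ⁻` -/

section Eigen

variable (J : OrthogonalComplexStructure V)

/-- The complexification `J_ℂ` of `J`. -/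
def JC : Module.End ℂ (VC V) := J.toLin.baseChange ℂ

/-- `V_J⁺`, the eigenspace of `J_ℂ` for the eigenvalue `i`. -/
def VPlus : Submodule ℂ (VC V) := (JC J).eigenspace Complex.I

/-- `V_J⁻`, the eigenspace of `J_ℂ` for the eigenvalue `-i`. -/
def VMinus : Submodule ℂ (VC V) := (JC J).eigenspace (-Complex.I)

theorem bilinC_JC (x y : VC V) : bilinC V (JC J x) (JC J y) = bilinC V x y := by
  induction x using TensorProduct.induction_on with
  | zero => simp
  | add x x' hx hx' => simp only [map_add, LinearMap.add_apply, hx, hx']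
  | tmul a v =>
    induction y using TensorProduct.induction_on with
    | zero => simp
    | add y y' hy hy' => simp only [map_add, hy, hy']
    | tmul b w => simp [bilinC, JC, J.inner_map_map]

/-- An eigenspace of `J_ℂ` for an eigenvalue of square `-1` is isotropic. -/
theorem quadC_eq_zero {c : ℂ} (hc : c * c = -1) {w : VC V} (hw : JC J w = c • w) :
    quadC V w = 0 := by
  have h := bilinC_JC J w w
  rw [hw] at h
  simp only [map_smul, LinearMap.smul_apply, smul_eq_mul, ← mul_assoc, hc] at h
  have h2 : (2 : ℂ) * bilinC V w w = 0 := by linear_combination -h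
  exact (mul_eq_zero.1 h2).resolve_left two_ne_zero

theorem quadC_VPlus (w : VPlus J) : quadC V w = 0 :=
  quadC_eq_zero J Complex.I_mul_I (Module.End.mem_eigenspace_iff.1 w.2)

theorem quadC_VMinus (w : VMinus J) : quadC V w = 0 :=
  quadC_eq_zero J (by simp) (Module.End.mem_eigenspace_iff.1 w.2)

theorem tmul_I_smul (r : ℝ) (v : V) : (1 : ℂ) ⊗ₜ[ℝ] (r • v) = (r : ℂ) • ((1 : ℂ) ⊗ₜ[ℝ] v) := by
  rw [← TensorProduct.smul_tmul, TensorProduct.smul_tmul']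
  simp

/-- `γ⁺ : V_J → V_J⁺`, `v ↦ (v - i J v) / √2`, a complex-linear map. -/
def gammaPlus : VJ J →ₗ[ℂ] VPlus J where
  toFun v := ⟨((Real.sqrt 2 : ℝ) : ℂ)⁻¹ •
      ((1 : ℂ) ⊗ₜ[ℝ] VJ.toV J v - Complex.I • ((1 : ℂ) ⊗ₜ[ℝ] J.toLin (VJ.toV J v))), by
    rw [VPlus, Module.End.mem_eigenspace_iff]
    simp only [JC, map_smul, map_sub, LinearMap.baseChange_tmul, J.apply_apply,
      TensorProduct.tmul_neg]
    rw [smul_comm Complex.I, smul_sub Complex.I, smul_smul Complex.I, Complex.I_mul_I]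
    module⟩
  map_add' v w := by
    apply Subtype.ext
    simp only [map_add, TensorProduct.tmul_add, Submodule.coe_add]
    module
  map_smul' c v := by
    apply Subtype.ext
    simp only [VJ.toV_smul, map_add, map_smul, J.apply_apply, TensorProduct.tmul_add,
      tmul_I_smul, TensorProduct.tmul_neg, smul_neg, RingHom.id_apply, Submodule.coe_smul]
    conv_rhs => rw [← Complex.re_add_im c]
    match_scalars
    · ring
    · ring_nf
      simp

/-- `γ⁻ : V_J → V_J⁻`, `v ↦ (v + i J v) / √2`, a conjugate-linear map. -/
def gammaMinus : VJ J →ₛₗ[starRingEnd ℂ] VMinus J where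
  toFun v := ⟨((Real.sqrt 2 : ℝ) : ℂ)⁻¹ •
      ((1 : ℂ) ⊗ₜ[ℝ] VJ.toV J v + Complex.I • ((1 : ℂ) ⊗ₜ[ℝ] J.toLin (VJ.toV J v))), by
    rw [VMinus, Module.End.mem_eigenspace_iff]
    simp only [JC, map_smul, map_add, LinearMap.baseChange_tmul, J.apply_apply,
      TensorProduct.tmul_neg]
    rw [smul_comm (-Complex.I), smul_add (-Complex.I), smul_smul (-Complex.I), neg_mul,
      Complex.I_mul_I]
    module⟩
  map_add' v w := by
    apply Subtype.ext
    simp only [map_add, TensorProduct.tmul_add, Submodule.coe_add]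
    module
  map_smul' c v := by
    apply Subtype.ext
    simp only [VJ.toV_smul, map_add, map_smul, J.apply_apply, TensorProduct.tmul_add,
      tmul_I_smul, TensorProduct.tmul_neg, smul_neg, Submodule.coe_smul]
    conv_rhs => rw [← Complex.re_add_im c]
    simp only [map_add, map_mul, Complex.conj_ofReal, Complex.conj_I]
    match_scalars
    · ring
    · ring_nf
      simp

end Eigen

/-! ### Extension of `γ⁺` and `γ⁻` to exterior algebras -/

/-- The opposite of a complex algebra `A`, with the conjugate complex structure. Complex algebra
homomorphisms into it are the conjugate-linear anti-homomorphisms into `A`. -/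
def ConjOp (A : Type u) : Type u := Aᵐᵒᵖ

namespace ConjOp

variable (A : Type u) [Ring A]

instance : Ring (ConjOp A) := inferInstanceAs (Ring Aᵐᵒᵖ)

/-- The identity map from `ConjOp A` to `A`. -/
def toA : ConjOp A ≃+ A := (MulOpposite.opAddEquiv (α := A)).symm

theorem toA_mul (x y : ConjOp A) : toA A (x * y) = toA A y * toA A x := rfl

theorem toA_one : toA A 1 = 1 := rfl

variable [Algebra ℂ A]

instance : Algebra ℂ (ConjOp A) :=
  RingHom.toAlgebra' ((algebraMap ℂ Aᵐᵒᵖ).comp (starRingEnd ℂ))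
    fun c x => Algebra.commutes (A := Aᵐᵒᵖ) (conj c) x

theorem toA_smul (c : ℂ) (x : ConjOp A) : toA A (c • x) = conj c • toA A x := by
  rw [Algebra.smul_def, toA_mul, Algebra.smul_def, Algebra.commutes]
  rfl

end ConjOp

section Functorial

variable (J : OrthogonalComplexStructure V)

/-- `γ⁺ : ⋀(V_J) → ⋀(V_J⁺)`, the isomorphism of algebras induced by `γ⁺ : V_J → V_J⁺`. -/
def extGammaPlus : ExteriorAlgebra ℂ (VJ J) →ₐ[ℂ] ExteriorAlgebra ℂ (VPlus J) :=
  ExteriorAlgebra.map (gammaPlus J)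

/-- The extension of `γ⁻` to `⋀(V_J)`, as a homomorphism into the conjugate opposite algebra. -/
def extGammaMinusOp : ExteriorAlgebra ℂ (VJ J) →ₐ[ℂ] ConjOp (ExteriorAlgebra ℂ (VMinus J)) :=
  ExteriorAlgebra.lift ℂ ⟨
    { toFun := fun v => (ConjOp.toA _).symm (ExteriorAlgebra.ι ℂ (gammaMinus J v))
      map_add' := fun v w => by simp only [map_add]
      map_smul' := fun c v => by
        apply (ConjOp.toA _).injective
        rw [RingHom.id_apply, ConjOp.toA_smul]
        simp only [LinearMap.map_smulₛₗ, AddEquiv.apply_symm_apply, RingHom.id_apply] },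
    fun v => by
      apply (ConjOp.toA _).injective
      rw [ConjOp.toA_mul]
      simp⟩

/-- `γ⁻ : ⋀(V_J) → ⋀(V_J⁻)`, the conjugate-linear anti-isomorphism of algebras that extends
`γ⁻ : V_J → V_J⁻`. -/
def extGammaMinus : ExteriorAlgebra ℂ (VJ J) →ₛₗ[starRingEnd ℂ] ExteriorAlgebra ℂ (VMinus J) where
  toFun ξ := ConjOp.toA _ (extGammaMinusOp J ξ)
  map_add' ξ η := by simp only [map_add]
  map_smul' c ξ := by rw [map_smul, ConjOp.toA_smul]

theorem extGammaMinus_ι (v : VJ J) :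
    extGammaMinus J (ExteriorAlgebra.ι ℂ v) = ExteriorAlgebra.ι ℂ (gammaMinus J v) := by
  change ConjOp.toA _ (extGammaMinusOp J (ExteriorAlgebra.ι ℂ v)) = _
  rw [extGammaMinusOp, ExteriorAlgebra.lift_ι_apply]
  simp

theorem extGammaMinus_one : extGammaMinus J 1 = 1 := by
  change ConjOp.toA _ (extGammaMinusOp J 1) = _
  rw [map_one, ConjOp.toA_one]

theorem extGammaMinus_mul (ξ η : ExteriorAlgebra ℂ (VJ J)) :
    extGammaMinus J (ξ * η) = extGammaMinus J η * extGammaMinus J ξ := by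
  change ConjOp.toA _ (extGammaMinusOp J (ξ * η)) = _
  rw [map_mul, ConjOp.toA_mul]
  rfl

/-! ### The inclusions of `⋀(V_J^±)` in `⋀(V_ℂ)` and in `C(V_ℂ)` -/

/-- The inclusion `⋀(V_J⁺) ⊆ ⋀(V_ℂ)`. -/
def plusToExt : ExteriorAlgebra ℂ (VPlus J) →ₐ[ℂ] Ext V :=
  ExteriorAlgebra.map (VPlus J).subtype

/-- The inclusion `⋀(V_J⁻) ⊆ ⋀(V_ℂ)`. -/
def minusToExt : ExteriorAlgebra ℂ (VMinus J) →ₐ[ℂ] Ext V :=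
  ExteriorAlgebra.map (VMinus J).subtype

/-- The inclusion `⋀(V_J⁺) = C(V_J⁺) ⊆ C(V_ℂ)`, which exists since `V_J⁺` is isotropic. -/
def plusToCl : ExteriorAlgebra ℂ (VPlus J) →ₐ[ℂ] Cl V :=
  ExteriorAlgebra.lift ℂ ⟨(CliffordAlgebra.ι (quadC V)).comp (VPlus J).subtype, fun w => by
    simp [quadC_VPlus]⟩

/-- The inclusion `⋀(V_J⁻) = C(V_J⁻) ⊆ C(V_ℂ)`, which exists since `V_J⁻` is isotropic. -/
def minusToCl : ExteriorAlgebra ℂ (VMinus J) →ₐ[ℂ] Cl V :=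
  ExteriorAlgebra.lift ℂ ⟨(CliffordAlgebra.ι (quadC V)).comp (VMinus J).subtype, fun w => by
    simp [quadC_VMinus]⟩

/-- `ν` is the linear isomorphism `⋀(V_ℂ) → C(V_ℂ)` that sends `γ⁻(ξ) ∧ γ⁺(η)` to the Clifford
product `γ⁻(ξ) γ⁺(η)`. -/
def IsOrdering (ν : Ext V ≃ₗ[ℂ] Cl V) : Prop :=
  ∀ ξ η : ExteriorAlgebra ℂ (VJ J),
    ν (minusToExt J (extGammaMinus J ξ) * plusToExt J (extGammaPlus J η))
      = minusToCl J (extGammaMinus J ξ) * plusToCl J (extGammaPlus J η)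

/-! ### The Berezin expectation -/

/-- `γ = ∑ₘ γ⁺(vₘ) ∧ γ⁻(vₘ)`, for a unitary basis `v` of `V_J`. -/
def gammaForm {M : ℕ} (v : OrthonormalBasis (Fin M) ℂ (VJ J)) : Ext V :=
  ∑ m, ExteriorAlgebra.ι ℂ (gammaPlus J (v m) : VC V)
    * ExteriorAlgebra.ι ℂ (gammaMinus J (v m) : VC V)

/-- `ω = (-γ)^M / M!`. -/
def omegaForm {M : ℕ} (v : OrthonormalBasis (Fin M) ℂ (VJ J)) : Ext V :=
  (M.factorial : ℂ)⁻¹ • (-gammaForm J v) ^ M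

/-- The projection of `⋀(V_ℂ)` onto `⋀^k(V_ℂ)` along the sum of the other exterior powers; it is
the orthogonal projection, as different exterior powers are perpendicular. -/
def projDegree (k : ℕ) : Ext V →ₗ[ℂ] Ext V :=
  GradedAlgebra.proj (fun i : ℕ => ⋀[ℂ]^i (VC V)) k

/-- `E` is the Berezin expectation: `P (ζ ∧ e^{-γ}) = E(ζ) ω` for every `ζ`, where `P` is the
projection onto the top exterior power; `γ` and `ω` may be computed in any unitary basis of `V_J`.
The exponential is the finite sum `∑ (-γ)^k / k!`, as `γ` is nilpotent. -/
def IsBerezinExpectation (E : Ext V →ₗ[ℂ] ℂ) : Prop :=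
  ∀ (M : ℕ) (v : OrthonormalBasis (Fin M) ℂ (VJ J)) (ζ : Ext V),
    projDegree (2 * M) (ζ * IsNilpotent.exp (-gammaForm J v)) = E ζ • omegaForm J v

end Functorial

end BerezinClifford

end

/-!
The maps `ν`, `τ` and `E` are all governed by identities for left multiplication by a vector
`z : V_ℂ`, in which the correction terms are contractions `⌋` (`CliffordAlgebra.contractLeft`).

Write `B = (· | ·)` and let `A(x, y) = -i (J x | y)`, an alternating form. For a bilinear form `F`
with `F(z, z) = (z | z)`, Mathlib's `CliffordAlgebra.changeForm` is the linear isomorphism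
`λ_F : ⋀(V_ℂ) → C(V_ℂ)` with `λ_F(1) = 1` and `λ_F(z ∧ x) = z λ_F(x) - F(z) ⌋ λ_F(x)`.

* In `C(V_ℂ)` one has `z a - Γ(a) z = 2 B(z) ⌋ a`. Hence a trace satisfies `τ(z a) = τ(B(z) ⌋ a)`,
  that is, `τ ∘ λ_B` kills every `z ∧ x`. So `τ` must be the scalar part of `λ_B⁻¹`, and the same
  identity shows that this functional is a trace.
* `ν` is `λ_{B + A}`: the form `B + A` vanishes on `V_J⁻ × V_ℂ` and on `V_J⁺ × V_J⁺`, so that no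
  correction arises when elements of `V_J⁻` are multiplied to the left of elements of `V_J⁺`.
  Uniqueness holds as the products `γ⁻(ξ) ∧ γ⁺(η)` span `⋀(V_ℂ)`.
* Consequently `f = τ ∘ ν` satisfies `f(1) = 1` and `f(z ∧ x) = -f(A(z) ⌋ x)`. On the other hand
  `A(z) ⌋ γ = -z`, so `A(z) ⌋ e^{-γ} = z ∧ e^{-γ}`; and contractions have no component in the top
  degree. It follows that `g(x) = P(x ∧ e^{-γ})` satisfies `g(1) = ω` and
  `g(z ∧ x) = -g(A(z) ⌋ x)`. Composition with the automorphism `λ_{-A}` of `⋀(V_ℂ)`, given by the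
  same formulas since `A(z, z) = 0`, turns this recursion into the vanishing on all `z ∧ x`. So the
  recursion determines a functional from its value at `1`, and `g = f ω`
  (`IsCliffordTrace.isBerezinExpectation`). This is both the existence of `E`, for all unitary
  bases at once, and the identity `E = τ ∘ ν`. Uniqueness of `E` amounts to `ω ≠ 0`, that is, to
  `g` not being zero; and it is not, since `e^{-γ}` is invertible.
-/

/-! ### Contractions in Clifford algebras -/

namespace CliffordAlgebra

variable {R M : Type*} [CommRing R] [AddCommGroup M] [Module R M] {Q : QuadraticForm R M}

theorem contractLeft_involute (d : Module.Dual R M) (x : CliffordAlgebra Q) :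
    contractLeft d (involute x) = -involute (contractLeft d x) := by
  induction x using CliffordAlgebra.left_induction with
  | algebraMap r => simp
  | add x y hx hy => simp only [map_add, hx, hy, neg_add]
  | ι_mul x m hx =>
    simp only [map_mul, involute_ι, neg_mul, map_neg, contractLeft_ι_mul, map_sub, map_smul, hx]
    simp

/-- Contraction with the polar form of `z` is the graded commutator with `z`. -/
theorem ι_mul_sub_involute_mul_ι (z : M) (x : CliffordAlgebra Q) :
    ι Q z * x - involute x * ι Q z = contractLeft (Q.polarBilin z) x := by
  induction x using CliffordAlgebra.left_induction with
  | algebraMap r => simp [Algebra.commutes]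
  | add x y hx hy => rw [map_add, map_add, ← hx, ← hy]; noncomm_ring
  | ι_mul x m hx =>
    have h : ι Q z * ι Q m = algebraMap R _ (Q.polarBilin z m) - ι Q m * ι Q z :=
      eq_sub_of_add_eq (ι_mul_ι_add_swap z m)
    rw [contractLeft_ι_mul, ← hx, map_mul, involute_ι, ← mul_assoc, h, sub_mul,
      ← Algebra.smul_def]
    noncomm_ring

/-- Contractions are antiderivations. -/
theorem contractLeft_mul (d : Module.Dual R M) (x y : CliffordAlgebra Q) :
    contractLeft d (x * y) = contractLeft d x * y + involute x * contractLeft d y := by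
  induction x using CliffordAlgebra.left_induction with
  | algebraMap r => simp [contractLeft_algebraMap_mul]
  | add x x' hx hx' => simp only [add_mul, map_add, hx, hx']; abel
  | ι_mul x m hx =>
    rw [mul_assoc, contractLeft_ι_mul, hx, contractLeft_ι_mul, map_mul, involute_ι, mul_add,
      sub_mul, smul_mul_assoc]
    noncomm_ring

theorem changeForm_involute {Q' : QuadraticForm R M} {B : LinearMap.BilinForm R M}
    (h : B.toQuadraticMap = Q' - Q) (x : CliffordAlgebra Q) :
    changeForm h (involute x) = involute (changeForm h x) := by
  induction x using CliffordAlgebra.left_induction with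
  | algebraMap r => simp
  | add x y hx hy => simp only [map_add, hx, hy]
  | ι_mul m x hx =>
    simp only [map_mul, involute_ι, neg_mul, map_neg, changeForm_ι_mul, map_sub, hx,
      contractLeft_involute]
    abel

end CliffordAlgebra

/-! ### Contractions in exterior algebras -/

namespace ExteriorAlgebra

variable {R M : Type*} [CommRing R] [AddCommGroup M] [Module R M]

/-- The graded commutator with a vector vanishes in the exterior algebra. -/
theorem ι_mul_eq_involute_mul_ι (z : M) (x : ExteriorAlgebra R M) :
    ι R z * x = CliffordAlgebra.involute x * ι R z := by
  have h := CliffordAlgebra.ι_mul_sub_involute_mul_ι (Q := (0 : QuadraticForm R M)) z x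
  have h0 : (0 : QuadraticForm R M).polarBilin z = 0 :=
    LinearMap.ext fun y => by simp [QuadraticMap.polar]
  rwa [h0, map_zero, LinearMap.zero_apply, sub_eq_zero] at h

/-- A linear map on the exterior algebra is determined by its values at `1` and on the
augmentation ideal. -/
theorem linearMap_ext_ι_mul {N : Type*} [AddCommGroup N] [Module R N]
    {f g : ExteriorAlgebra R M →ₗ[R] N} (h1 : f 1 = g 1)
    (h : ∀ z x, f (ι R z * x) = g (ι R z * x)) : f = g := by
  refine LinearMap.ext fun x => ?_
  induction x using CliffordAlgebra.left_induction with
  | algebraMap r => simp only [Algebra.algebraMap_eq_smul_one, map_smul, h1]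
  | add x y hx hy => rw [map_add, map_add, hx, hy]
  | ι_mul x m _ => exact h m x

/-- For an alternating form `A`, the recursion `f (z ∧ x) = -f (A z ⌋ x)` determines `f` from `f 1`:
composed with the automorphism `changeForm` of `-A`, it says that `f` kills all `z ∧ x`. -/
theorem linearMap_ext_contractLeft {N : Type*} [AddCommGroup N] [Module R N]
    {A : LinearMap.BilinForm R M} (hA : A.toQuadraticMap = 0)
    {f g : ExteriorAlgebra R M →ₗ[R] N} (h1 : f 1 = g 1)
    (hf : ∀ z x, f (ι R z * x) = -f (CliffordAlgebra.contractLeft (A z) x))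
    (hg : ∀ z x, g (ι R z * x) = -g (CliffordAlgebra.contractLeft (A z) x)) : f = g := by
  have hA' : (-A).toQuadraticMap = (0 : QuadraticForm R M) - 0 := by
    rw [LinearMap.BilinMap.toQuadraticMap_neg, hA, neg_zero, sub_zero]
  let χ : ExteriorAlgebra R M ≃ₗ[R] ExteriorAlgebra R M := CliffordAlgebra.changeFormEquiv hA'
  have hχ : ∀ z x, χ (ι R z * x) = ι R z * χ x + CliffordAlgebra.contractLeft (A z) (χ x) := by
    intro z x
    refine (CliffordAlgebra.changeForm_ι_mul hA' z x).trans ?_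
    rw [LinearMap.neg_apply, map_neg, LinearMap.neg_apply, sub_neg_eq_add]
    rfl
  have hχ1 : χ 1 = 1 := CliffordAlgebra.changeForm_one hA'
  have h : f ∘ₗ χ.toLinearMap = g ∘ₗ χ.toLinearMap := by
    refine linearMap_ext_ι_mul ?_ fun z x => ?_
    · simpa [hχ1] using h1
    · simp [hχ, hf, hg]
  refine LinearMap.ext fun x => ?_
  obtain ⟨y, rfl⟩ := χ.surjective x
  exact LinearMap.congr_fun h y

theorem contractLeft_mem_exteriorPower (d : Module.Dual R M) {n : ℕ} {x : ExteriorAlgebra R M}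
    (hx : x ∈ ⋀[R]^(n + 1) M) : CliffordAlgebra.contractLeft d x ∈ ⋀[R]^n M := by
  induction n generalizing x with
  | zero =>
    rw [exteriorPower, zero_add, pow_one] at hx
    obtain ⟨m, rfl⟩ := hx
    rw [exteriorPower, pow_zero, ι, CliffordAlgebra.contractLeft_ι]
    exact ⟨d m, (Algebra.algebraMap_eq_smul_one _).symm⟩
  | succ n ih =>
    rw [exteriorPower, pow_succ'] at hx
    induction hx using Submodule.mul_induction_on' with
    | add x _ y _ hx hy => rw [map_add]; exact add_mem hx hy
    | mem_mul_mem m hm y hy =>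
      obtain ⟨m, rfl⟩ := hm
      rw [ι, CliffordAlgebra.contractLeft_ι_mul]
      refine sub_mem (Submodule.smul_mem _ _ hy) ?_
      rw [exteriorPower, pow_succ']
      exact Submodule.mul_mem_mul ⟨m, rfl⟩ (ih hy)

/-- In the top degree a contraction has no component, as it would come from one degree higher. -/
theorem proj_contractLeft_eq_zero (d : Module.Dual R M) {n : ℕ} (hn : ⋀[R]^(n + 1) M = ⊥)
    (x : ExteriorAlgebra R M) :
    GradedAlgebra.proj (fun i : ℕ => ⋀[R]^i M) n (CliffordAlgebra.contractLeft d x) = 0 := by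
  induction x using DirectSum.Decomposition.inductionOn (fun i : ℕ => ⋀[R]^i M) with
  | zero => simp
  | add x y hx hy => rw [map_add, map_add, hx, hy, add_zero]
  | @homogeneous k x =>
    obtain ⟨x, hx⟩ := x
    rw [GradedAlgebra.proj_apply]
    cases k with
    | zero =>
      rw [exteriorPower, pow_zero] at hx
      obtain ⟨r, rfl⟩ := Submodule.mem_one.1 hx
      have h : CliffordAlgebra.contractLeft d (algebraMap R (ExteriorAlgebra R M) r) = 0 :=
        CliffordAlgebra.contractLeft_algebraMap _ d r
      change ((DirectSum.decompose (fun i : ℕ => ⋀[R]^i M) (CliffordAlgebra.contractLeft d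
        (algebraMap R (ExteriorAlgebra R M) r)) n : _) : ExteriorAlgebra R M) = 0
      rw [h]
      simp
    | succ k =>
      rcases eq_or_ne k n with rfl | hk
      · rw [hn, Submodule.mem_bot] at hx
        simp [hx]
      · exact DirectSum.decompose_of_mem_ne _ (contractLeft_mem_exteriorPower d hx) hk

end ExteriorAlgebra

/-! ### The exponential of a nilpotent element under a derivation -/

namespace IsNilpotent

/-- If `D` obeys the Leibniz rule on products with left factor `g`, and `z = D g` commutes with
`g`, then `D (exp g) = D g * exp g`. -/
theorem map_exp_of_map_mul {R A : Type*} [CommRing R] [Ring A] [Algebra R A] [Module ℚ A]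
    {D : A →ₗ[R] A} {g z : A} (hg : IsNilpotent g) (hz : Commute z g) (h1 : D 1 = 0)
    (hD : ∀ x, D (g * x) = z * x + g * D x) : D (exp g) = z * exp g := by
  have hpow : ∀ k : ℕ, D (g ^ (k + 1)) = (k + 1) • (z * g ^ k) := by
    intro k
    induction k with
    | zero => simpa [h1] using hD 1
    | succ k ih =>
      rw [pow_succ' g (k + 1), hD, ih, mul_smul_comm, ← mul_assoc, ← hz.eq, mul_assoc,
        ← pow_succ', succ_nsmul' _ (k + 1)]
  obtain ⟨N, hN⟩ := hg
  have hN1 : g ^ (N + 1) = 0 := by rw [_root_.pow_succ, hN, zero_mul]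
  rw [congrArg D (exp_eq_sum hN1), exp_eq_sum hN,
    Finset.sum_range_succ', map_add, map_sum, map_rat_smul, pow_zero, h1, smul_zero, add_zero,
    Finset.mul_sum]
  refine Finset.sum_congr rfl fun k _ => ?_
  have hk : (k.factorial : ℚ) ≠ 0 := by exact_mod_cast k.factorial_ne_zero
  have hk' : (k : ℚ) + 1 ≠ 0 := by positivity
  have hc : ((k + 1).factorial : ℚ)⁻¹ * ((k + 1 : ℕ) : ℚ) = (k.factorial : ℚ)⁻¹ := by
    rw [Nat.factorial_succ]
    push_cast
    field_simp
  rw [map_rat_smul, hpow, ← Nat.cast_smul_eq_nsmul ℚ, smul_smul, hc, mul_smul_comm]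

end IsNilpotent

noncomputable section

namespace BerezinClifford

universe u

variable {V : Type u} [NormedAddCommGroup V] [InnerProductSpace ℝ V]

open CliffordAlgebra

/-! ### The Clifford trace -/

theorem bilinC_tmul (a b : ℂ) (v w : V) :
    bilinC V (a ⊗ₜ v) (b ⊗ₜ w) = a * b * (inner ℝ v w : ℝ) := by
  simp [bilinC]
  ring

theorem bilinC_comm (x y : VC V) : bilinC V x y = bilinC V y x := by
  induction x using TensorProduct.induction_on with
  | zero => simp
  | add x x' hx hx' => simp only [map_add, LinearMap.add_apply, hx, hx']
  | tmul a v =>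
    induction y using TensorProduct.induction_on with
    | zero => simp
    | add y y' hy hy' => simp only [map_add, LinearMap.add_apply, hy, hy']
    | tmul b w => rw [bilinC_tmul, bilinC_tmul, real_inner_comm, mul_comm a]

theorem quadC_polarBilin (z : VC V) : (quadC V).polarBilin z = (2 : ℂ) • bilinC V z := by
  ext y
  simp [quadC, LinearMap.BilinMap.polar_toQuadraticMap, bilinC_comm _ z]
  ring

theorem toQuadraticMap_bilinC : (bilinC V).toQuadraticMap = quadC V - 0 :=
  (sub_zero _).symm

variable (V) in
/-- The symmetrization `⋀(V_ℂ) ≃ C(V_ℂ)`. It is encoded as the change of form by `(· | ·)`, which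
sends a wedge product of pairwise orthogonal vectors to their Clifford product. -/
def symmetrization : Ext V ≃ₗ[ℂ] Cl V :=
  changeFormEquiv (Q := 0) toQuadraticMap_bilinC

theorem symmetrization_one : symmetrization V 1 = 1 :=
  changeForm_one toQuadraticMap_bilinC

theorem symmetrization_ι_mul (z : VC V) (x : Ext V) :
    symmetrization V (ExteriorAlgebra.ι ℂ z * x)
      = ι (quadC V) z * symmetrization V x - contractLeft (bilinC V z) (symmetrization V x) :=
  changeForm_ι_mul toQuadraticMap_bilinC _ _

theorem symmetrization_involute (x : Ext V) :
    symmetrization V (involute x) = involute (symmetrization V x) :=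
  changeForm_involute toQuadraticMap_bilinC _

namespace IsCliffordTrace

variable {τ : Cl V →ₗ[ℂ] ℂ} (hτ : IsCliffordTrace τ)
include hτ

theorem map_ι_mul (z : VC V) (x : Cl V) :
    τ (ι (quadC V) z * x) = τ (contractLeft (bilinC V z) x) := by
  have h := congrArg τ (ι_mul_sub_involute_mul_ι (Q := quadC V) z x)
  have h2 := hτ.map_involute (ι (quadC V) z * x)
  rw [map_mul, involute_ι, neg_mul, map_neg] at h2
  rw [quadC_polarBilin, map_sub, hτ.map_mul_comm (involute x), map_smul, LinearMap.smul_apply,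
    map_smul, smul_eq_mul] at h
  linear_combination (1 / 2) * h - (1 / 2) * h2

theorem symmetrization_ι_mul (z : VC V) (x : Ext V) :
    τ (symmetrization V (ExteriorAlgebra.ι ℂ z * x)) = 0 := by
  rw [BerezinClifford.symmetrization_ι_mul, map_sub, hτ.map_ι_mul, sub_self]

theorem unique {τ' : Cl V →ₗ[ℂ] ℂ} (hτ' : IsCliffordTrace τ') : τ = τ' := by
  have h : τ ∘ₗ (symmetrization V).toLinearMap = τ' ∘ₗ (symmetrization V).toLinearMap := by
    refine ExteriorAlgebra.linearMap_ext_ι_mul ?_ fun z x => ?_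
    · simp [symmetrization_one, hτ.map_one, hτ'.map_one]
    · simp [hτ.symmetrization_ι_mul, hτ'.symmetrization_ι_mul]
  ext a
  obtain ⟨x, rfl⟩ := (symmetrization V).surjective a
  exact LinearMap.congr_fun h x

end IsCliffordTrace

variable (V) in
/-- The scalar part of the inverse image in `⋀(V_ℂ)` under the symmetrization. -/
def cliffordTrace : Cl V →ₗ[ℂ] ℂ :=
  (ExteriorAlgebra.algebraMapInv (R := ℂ) (M := VC V)).toLinearMap
    ∘ₗ (symmetrization V).symm.toLinearMap

theorem cliffordTrace_symmetrization (x : Ext V) :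
    cliffordTrace V (symmetrization V x) = ExteriorAlgebra.algebraMapInv x := by
  simp [cliffordTrace]

theorem cliffordTrace_involute (a : Cl V) : cliffordTrace V (involute a) = cliffordTrace V a := by
  obtain ⟨x, rfl⟩ := (symmetrization V).surjective a
  rw [← symmetrization_involute, cliffordTrace_symmetrization, cliffordTrace_symmetrization]
  induction x using CliffordAlgebra.left_induction with
  | algebraMap r => simp
  | add x y hx hy => simp only [map_add, hx, hy]
  | ι_mul x m _ =>
    change ExteriorAlgebra.algebraMapInv (involute (ι 0 m * x))
      = ExteriorAlgebra.algebraMapInv (ExteriorAlgebra.ι ℂ m * x)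
    rw [map_mul, involute_ι, neg_mul, map_neg]
    change -ExteriorAlgebra.algebraMapInv (ExteriorAlgebra.ι ℂ m * involute x) = _
    rw [map_mul, map_mul]
    simp [ExteriorAlgebra.algebraMapInv]

theorem cliffordTrace_ι_mul (z : VC V) (a : Cl V) :
    cliffordTrace V (ι (quadC V) z * a) = cliffordTrace V (contractLeft (bilinC V z) a) := by
  obtain ⟨x, rfl⟩ := (symmetrization V).surjective a
  rw [← sub_eq_zero, ← map_sub, ← symmetrization_ι_mul, cliffordTrace_symmetrization, map_mul]
  simp [ExteriorAlgebra.algebraMapInv]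

theorem cliffordTrace_mul_ι (z : VC V) (a : Cl V) :
    cliffordTrace V (a * ι (quadC V) z) = cliffordTrace V (ι (quadC V) z * a) := by
  have h := congrArg (cliffordTrace V) (ι_mul_sub_involute_mul_ι (Q := quadC V) z (involute a))
  rw [involute_involute, quadC_polarBilin, map_sub, cliffordTrace_ι_mul, map_smul,
    LinearMap.smul_apply, map_smul, contractLeft_involute, map_neg, cliffordTrace_involute,
    smul_eq_mul] at h
  rw [cliffordTrace_ι_mul]
  linear_combination -h

theorem isCliffordTrace_cliffordTrace : IsCliffordTrace (cliffordTrace V) where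
  map_one := by rw [← symmetrization_one, cliffordTrace_symmetrization, map_one]
  map_involute := cliffordTrace_involute
  map_mul_comm a b := by
    induction a using CliffordAlgebra.left_induction generalizing b with
    | algebraMap r => rw [Algebra.commutes]
    | add x y hx hy => simp only [add_mul, mul_add, map_add, hx, hy]
    | ι_mul x m hx => rw [mul_assoc, ← cliffordTrace_mul_ι, mul_assoc, hx, mul_assoc]

/-! ### The ordering isomorphism -/

variable (J : OrthogonalComplexStructure V)

theorem JC_JC (x : VC V) : JC J (JC J x) = -x := by
  induction x using TensorProduct.induction_on with
  | zero => simp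
  | add x x' hx hx' => simp only [map_add, hx, hx', neg_add]
  | tmul a v => simp [JC, J.apply_apply, TensorProduct.tmul_neg]

theorem bilinC_JC_left (x y : VC V) : bilinC V (JC J x) y = -bilinC V x (JC J y) := by
  rw [← bilinC_JC J (JC J x) y, JC_JC, map_neg, LinearMap.neg_apply]

theorem bilinC_eq_zero {c : ℂ} (hc : c * c = -1) {x y : VC V} (hx : JC J x = c • x)
    (hy : JC J y = c • y) : bilinC V x y = 0 := by
  have h := bilinC_JC J x y
  rw [hx, hy] at h
  simp only [map_smul, LinearMap.smul_apply, smul_eq_mul, ← mul_assoc, hc] at h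
  linear_combination (-1 / 2) * h

/-- The alternating form `(x, y) ↦ -i (J x | y)` on `V_ℂ`. It is `(· | ·)` on `V_J⁺ × V_ℂ` and
`-(· | ·)` on `V_J⁻ × V_ℂ`. -/
def twistForm : LinearMap.BilinForm ℂ (VC V) :=
  -Complex.I • (bilinC V).comp (JC J) LinearMap.id

theorem twistForm_apply (x y : VC V) :
    twistForm J x y = -(Complex.I * bilinC V (JC J x) y) := by
  simp [twistForm]

theorem toQuadraticMap_twistForm : (twistForm J).toQuadraticMap = 0 := by
  refine QuadraticMap.ext fun x => ?_
  have h := bilinC_JC_left J x x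
  rw [bilinC_comm x] at h
  rw [LinearMap.BilinMap.toQuadraticMap_apply, twistForm_apply]
  simp only [_root_.zero_apply]
  linear_combination (-Complex.I / 2) * h

theorem toQuadraticMap_bilinC_add_twistForm :
    (bilinC V + twistForm J).toQuadraticMap = quadC V - 0 := by
  rw [LinearMap.BilinMap.toQuadraticMap_add, toQuadraticMap_twistForm, add_zero, sub_zero]
  rfl

/-- The isomorphism `ν` that multiplies elements of `V_J⁻` to the left of elements of `V_J⁺`: the
change of form by `(x | y) - i (J x | y)`, which is zero for `x ∈ V_J⁻` and is `2 (x | y)` for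
`x ∈ V_J⁺`. -/
def normalOrdering : Ext V ≃ₗ[ℂ] Cl V :=
  changeFormEquiv (Q := 0) (toQuadraticMap_bilinC_add_twistForm J)

theorem normalOrdering_one : normalOrdering J 1 = 1 :=
  changeForm_one (toQuadraticMap_bilinC_add_twistForm J)

theorem normalOrdering_ι_mul (z : VC V) (x : Ext V) :
    normalOrdering J (ExteriorAlgebra.ι ℂ z * x) = ι (quadC V) z * normalOrdering J x
      - contractLeft ((bilinC V + twistForm J) z) (normalOrdering J x) :=
  changeForm_ι_mul (toQuadraticMap_bilinC_add_twistForm J) _ _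

theorem normalOrdering_contractLeft (d : Module.Dual ℂ (VC V)) (x : Ext V) :
    normalOrdering J (contractLeft d x) = contractLeft d (normalOrdering J x) :=
  changeForm_contractLeft (toQuadraticMap_bilinC_add_twistForm J) _ _

variable {J}

theorem JC_VPlus (w : VPlus J) : JC J w = Complex.I • (w : VC V) :=
  Module.End.mem_eigenspace_iff.1 w.2

theorem JC_VMinus (w : VMinus J) : JC J w = -Complex.I • (w : VC V) :=
  Module.End.mem_eigenspace_iff.1 w.2

theorem twistForm_VPlus (w : VPlus J) : twistForm J w = bilinC V w := by
  refine LinearMap.ext fun y => ?_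
  rw [twistForm_apply, JC_VPlus, map_smul, LinearMap.smul_apply, smul_eq_mul, ← mul_assoc,
    Complex.I_mul_I, neg_one_mul, neg_neg]

theorem twistForm_VMinus (w : VMinus J) : twistForm J w = -bilinC V w := by
  refine LinearMap.ext fun y => ?_
  rw [twistForm_apply, JC_VMinus, map_smul, LinearMap.smul_apply, smul_eq_mul, ← mul_assoc,
    mul_neg, Complex.I_mul_I, neg_neg, one_mul, LinearMap.neg_apply]

/-- A functional that vanishes on `V_J⁺` contracts the subalgebra `C(V_J⁺)` to zero. -/
theorem contractLeft_plusToCl {d : Module.Dual ℂ (VC V)} (hd : ∀ w : VPlus J, d w = 0)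
    (η : ExteriorAlgebra ℂ (VPlus J)) : contractLeft d (plusToCl J η) = 0 := by
  induction η using CliffordAlgebra.left_induction with
  | algebraMap r =>
    rw [show plusToCl J (algebraMap ℂ _ r) = algebraMap ℂ _ r from (plusToCl J).commutes r,
      contractLeft_algebraMap]
  | add x y hx hy => rw [map_add, map_add, hx, hy, add_zero]
  | ι_mul x m hx =>
    have h : plusToCl J (ι 0 m) = ι (quadC V) m :=
      ExteriorAlgebra.lift_ι_apply ℂ _ _ m
    rw [map_mul, h, contractLeft_ι_mul, hx, hd]
    simp

theorem normalOrdering_plusToExt (η : ExteriorAlgebra ℂ (VPlus J)) :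
    normalOrdering J (plusToExt J η) = plusToCl J η := by
  induction η using CliffordAlgebra.left_induction with
  | algebraMap r =>
    rw [show plusToCl J (algebraMap ℂ _ r) = algebraMap ℂ _ r from (plusToCl J).commutes r,
      show plusToExt J (algebraMap ℂ _ r) = algebraMap ℂ _ r from (plusToExt J).commutes r,
      Algebra.algebraMap_eq_smul_one, map_smul, normalOrdering_one,
      Algebra.algebraMap_eq_smul_one]
  | add x y hx hy => simp only [map_add, hx, hy]
  | ι_mul x m hx =>
    have h : plusToCl J (ι 0 m) = ι (quadC V) m :=
      ExteriorAlgebra.lift_ι_apply ℂ _ _ m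
    have h' : plusToExt J (ι 0 m) = ExteriorAlgebra.ι ℂ (m : VC V) :=
      ExteriorAlgebra.map_apply_ι _ _
    rw [map_mul (plusToExt J), map_mul (plusToCl J), h, h', normalOrdering_ι_mul, hx,
      contractLeft_plusToCl, sub_zero]
    intro w
    rw [LinearMap.add_apply, twistForm_VPlus, LinearMap.add_apply,
      bilinC_eq_zero J Complex.I_mul_I (JC_VPlus m) (JC_VPlus w), add_zero]

theorem normalOrdering_minusToExt_mul (ξ : ExteriorAlgebra ℂ (VMinus J)) (x : Ext V) :
    normalOrdering J (minusToExt J ξ * x) = minusToCl J ξ * normalOrdering J x := by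
  induction ξ using CliffordAlgebra.left_induction generalizing x with
  | algebraMap r =>
    rw [show minusToCl J (algebraMap ℂ _ r) = algebraMap ℂ _ r from (minusToCl J).commutes r,
      show minusToExt J (algebraMap ℂ _ r) = algebraMap ℂ _ r from (minusToExt J).commutes r,
      ← Algebra.smul_def, ← Algebra.smul_def, map_smul]
  | add x y hx hy => simp only [map_add, add_mul, hx, hy]
  | ι_mul ξ m hx =>
    have h : minusToCl J (ι 0 m) = ι (quadC V) m :=
      ExteriorAlgebra.lift_ι_apply ℂ _ _ m
    have h' : minusToExt J (ι 0 m) = ExteriorAlgebra.ι ℂ (m : VC V) :=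
      ExteriorAlgebra.map_apply_ι _ _
    rw [map_mul (minusToExt J), map_mul (minusToCl J), h, h', mul_assoc,
      normalOrdering_ι_mul, hx, LinearMap.add_apply, twistForm_VMinus, add_neg_cancel, map_zero,
      LinearMap.zero_apply, sub_zero, mul_assoc]

variable (J)

theorem isOrdering_normalOrdering : IsOrdering J (normalOrdering J) := fun ξ η => by
  rw [normalOrdering_minusToExt_mul, normalOrdering_plusToExt]

theorem tmul_eq_gammaPlus_add_gammaMinus (v : VJ J) :
    (1 : ℂ) ⊗ₜ[ℝ] VJ.toV J v
      = ((Real.sqrt 2 : ℝ) : ℂ)⁻¹ • ((gammaPlus J v : VC V) + (gammaMinus J v : VC V)) := by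
  have h : ((Real.sqrt 2 : ℝ) : ℂ) ^ 2 = 2 := by
    rw [← Complex.ofReal_pow, Real.sq_sqrt zero_le_two, Complex.ofReal_ofNat]
  have h0 : ((Real.sqrt 2 : ℝ) : ℂ) ≠ 0 := by
    intro h0
    norm_num [h0] at h
  simp only [gammaPlus, gammaMinus, LinearMap.coe_mk, AddHom.coe_mk]
  match_scalars
  · field_simp
    rw [h]
    norm_num
  · ring

/-- `V_ℂ` is spanned by the ranges of `γ⁺` and `γ⁻`. -/
theorem gamma_induction {p : VC V → Prop} (hplus : ∀ v, p (gammaPlus J v))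
    (hminus : ∀ v, p (gammaMinus J v)) (hadd : ∀ x y, p x → p y → p (x + y))
    (hsmul : ∀ (c : ℂ) x, p x → p (c • x)) (z : VC V) : p z := by
  induction z using TensorProduct.induction_on with
  | zero => simpa using hsmul 0 _ (hplus 0)
  | add x y hx hy => exact hadd x y hx hy
  | tmul a v =>
    have h := tmul_eq_gammaPlus_add_gammaMinus J ((VJ.toV J).symm v)
    rw [AddEquiv.apply_symm_apply] at h
    rw [show a ⊗ₜ[ℝ] v = a • (1 : ℂ) ⊗ₜ[ℝ] v by
      rw [TensorProduct.smul_tmul', smul_eq_mul, mul_one], h]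
    exact hsmul _ _ (hsmul _ _ (hadd _ _ (hplus _) (hminus _)))

theorem minusToExt_extGammaMinus_mul_ι (ξ : ExteriorAlgebra ℂ (VJ J)) (v : VJ J) :
    minusToExt J (extGammaMinus J (ξ * ExteriorAlgebra.ι ℂ v))
      = ExteriorAlgebra.ι ℂ (gammaMinus J v : VC V) * minusToExt J (extGammaMinus J ξ) := by
  rw [extGammaMinus_mul, extGammaMinus_ι, map_mul]
  congr 1
  exact ExteriorAlgebra.map_apply_ι _ _

theorem plusToExt_extGammaPlus_ι_mul (v : VJ J) (η : ExteriorAlgebra ℂ (VJ J)) :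
    plusToExt J (extGammaPlus J (ExteriorAlgebra.ι ℂ v * η))
      = ExteriorAlgebra.ι ℂ (gammaPlus J v : VC V) * plusToExt J (extGammaPlus J η) := by
  rw [map_mul, map_mul, extGammaPlus, ExteriorAlgebra.map_apply_ι, plusToExt,
    ExteriorAlgebra.map_apply_ι]
  rfl

theorem involute_minusToExt_extGammaMinus (ξ : ExteriorAlgebra ℂ (VJ J)) :
    involute (minusToExt J (extGammaMinus J ξ)) = minusToExt J (extGammaMinus J (involute ξ)) := by
  induction ξ using CliffordAlgebra.right_induction with
  | algebraMap r =>
    rw [AlgHom.commutes, Algebra.algebraMap_eq_smul_one, LinearMap.map_smulₛₗ, extGammaMinus_one,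
      map_smul, map_one, map_smul, map_one]
  | add x y hx hy => simp only [map_add, hx, hy]
  | mul_ι v ξ hξ =>
    have h := minusToExt_extGammaMinus_mul_ι J ξ v
    have h' := minusToExt_extGammaMinus_mul_ι J (involute ξ) v
    rw [ExteriorAlgebra.ι] at h h'
    rw [map_mul involute, involute_ι, mul_neg, map_neg, map_neg, h, h', map_mul, hξ,
      ExteriorAlgebra.ι, involute_ι, neg_mul]

theorem span_gammaMinus_mul_gammaPlus :
    Submodule.span ℂ (Set.range fun p : ExteriorAlgebra ℂ (VJ J) × ExteriorAlgebra ℂ (VJ J) =>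
      minusToExt J (extGammaMinus J p.1) * plusToExt J (extGammaPlus J p.2)) = ⊤ := by
  set S := Submodule.span ℂ (Set.range fun p : ExteriorAlgebra ℂ (VJ J) ×
    ExteriorAlgebra ℂ (VJ J) =>
      minusToExt J (extGammaMinus J p.1) * plusToExt J (extGammaPlus J p.2)) with hS
  have hmem : ∀ ξ η, minusToExt J (extGammaMinus J ξ) * plusToExt J (extGammaPlus J η) ∈ S :=
    fun ξ η => Submodule.subset_span ⟨(ξ, η), rfl⟩
  have hmul : ∀ z x, x ∈ S → ExteriorAlgebra.ι ℂ z * x ∈ S := by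
    intro z x hx
    induction hx using Submodule.span_induction with
    | zero => rw [mul_zero]; exact S.zero_mem
    | add x y _ _ hx hy => rw [mul_add]; exact S.add_mem hx hy
    | smul c x _ hx => rw [mul_smul_comm]; exact S.smul_mem c hx
    | mem x hx =>
      obtain ⟨⟨ξ, η⟩, rfl⟩ := hx
      induction z using gamma_induction J with
      | hadd z w hz hw => rw [map_add, add_mul]; exact S.add_mem hz hw
      | hsmul c z hz => rw [map_smul, smul_mul_assoc]; exact S.smul_mem c hz
      | hminus v =>
        rw [← mul_assoc, ← minusToExt_extGammaMinus_mul_ι]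
        exact hmem _ _
      | hplus v =>
        -- An element of `V_J⁺` is moved past `γ⁻(ξ)` at the price of the grading automorphism.
        rw [← mul_assoc, ExteriorAlgebra.ι_mul_eq_involute_mul_ι,
          involute_minusToExt_extGammaMinus, mul_assoc, ← plusToExt_extGammaPlus_ι_mul]
        exact hmem _ _
  refine eq_top_iff.2 fun x _ => ?_
  induction x using CliffordAlgebra.left_induction with
  | algebraMap r =>
    rw [Algebra.algebraMap_eq_smul_one]
    have h := hmem 1 1
    rw [extGammaMinus_one, map_one, map_one, map_one, one_mul] at h
    exact S.smul_mem r h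
  | add x y hx hy => exact S.add_mem (hx trivial) (hy trivial)
  | ι_mul x m hx => exact hmul m x (hx trivial)

theorem IsOrdering.unique {ν ν' : Ext V ≃ₗ[ℂ] Cl V} (h : IsOrdering J ν) (h' : IsOrdering J ν') :
    ν = ν' := by
  refine LinearEquiv.toLinearMap_injective (LinearMap.ext_on_range
    (span_gammaMinus_mul_gammaPlus J) fun p => ?_)
  exact (h p.1 p.2).trans (h' p.1 p.2).symm

/-! ### The Berezin expectation -/

variable {J}

theorem bilinC_gammaPlus_gammaMinus (v w : VJ J) :
    bilinC V (gammaPlus J v) (gammaMinus J w) = inner ℂ w v := by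
  have h : (((Real.sqrt 2 : ℝ) : ℂ)⁻¹) ^ 2 = 1 / 2 := by
    rw [inv_pow, ← Complex.ofReal_pow, Real.sq_sqrt zero_le_two, Complex.ofReal_ofNat, one_div]
  simp only [gammaPlus, gammaMinus, LinearMap.coe_mk, AddHom.coe_mk, map_smul, map_sub, map_add,
    LinearMap.smul_apply, LinearMap.sub_apply, bilinC_tmul, J.inner_map_map, VJ.inner_def,
    smul_eq_mul]
  rw [J.inner_left (VJ.toV J w), J.inner_left (VJ.toV J v), real_inner_comm (VJ.toV J v),
    show inner ℝ (VJ.toV J w) (J.toLin (VJ.toV J v))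
      = -inner ℝ (VJ.toV J v) (J.toLin (VJ.toV J w)) by
        rw [real_inner_comm, J.inner_left]]
  set a := inner ℝ (VJ.toV J v) (VJ.toV J w)
  set b := inner ℝ (VJ.toV J v) (J.toLin (VJ.toV J w))
  rw [show (⟨a, - -b⟩ : ℂ) = a + b * Complex.I from by
    rw [neg_neg]; exact Complex.mk_eq_add_mul_I a b]
  push_cast
  linear_combination (2 * (a + b * Complex.I)) * h
    - (((Real.sqrt 2 : ℝ) : ℂ)⁻¹) ^ 2 * a * Complex.I_sq

theorem bilinC_gammaMinus_gammaPlus (v w : VJ J) :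
    bilinC V (gammaMinus J v) (gammaPlus J w) = inner ℂ v w := by
  rw [bilinC_comm, bilinC_gammaPlus_gammaMinus]

theorem bilinC_gammaPlus_gammaPlus (v w : VJ J) :
    bilinC V (gammaPlus J v) (gammaPlus J w) = 0 :=
  bilinC_eq_zero J Complex.I_mul_I (JC_VPlus _) (JC_VPlus _)

theorem bilinC_gammaMinus_gammaMinus (v w : VJ J) :
    bilinC V (gammaMinus J v) (gammaMinus J w) = 0 :=
  bilinC_eq_zero J (by simp) (JC_VMinus _) (JC_VMinus _)

theorem sum_inner_smul_gammaPlus {M : ℕ} (v : OrthonormalBasis (Fin M) ℂ (VJ J)) (w : VJ J) :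
    ∑ m, inner ℂ (v m) w • (gammaPlus J (v m) : VC V) = gammaPlus J w := by
  conv_rhs => rw [← v.sum_repr' w]
  simp

theorem sum_inner_smul_gammaMinus {M : ℕ} (v : OrthonormalBasis (Fin M) ℂ (VJ J)) (w : VJ J) :
    ∑ m, inner ℂ w (v m) • (gammaMinus J (v m) : VC V) = gammaMinus J w := by
  conv_rhs => rw [← v.sum_repr' w]
  simp

/-- The contraction of `γ` with `A(z)` is `-z`, where `A` is `twistForm J`; this is where the basis
has to be unitary. -/
theorem contractLeft_gammaForm {M : ℕ} (v : OrthonormalBasis (Fin M) ℂ (VJ J)) (z : VC V) :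
    contractLeft (twistForm J z) (gammaForm J v) = -ExteriorAlgebra.ι ℂ z := by
  have key : ∀ d : Module.Dual ℂ (VC V), contractLeft d (gammaForm J v)
      = ExteriorAlgebra.ι ℂ (∑ m, d (gammaPlus J (v m)) • (gammaMinus J (v m) : VC V)
        - ∑ m, d (gammaMinus J (v m)) • (gammaPlus J (v m) : VC V)) := by
    intro d
    rw [gammaForm, map_sum, ← Finset.sum_sub_distrib, map_sum]
    refine Finset.sum_congr rfl fun m _ => ?_
    rw [map_sub, map_smul, map_smul, ExteriorAlgebra.ι, contractLeft_ι_mul, contractLeft_ι,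
      ← Algebra.commutes, Algebra.smul_def (d (gammaMinus J (v m) : VC V))]
  induction z using gamma_induction J with
  | hadd x y hx hy => rw [map_add, map_add, LinearMap.add_apply, hx, hy, map_add, neg_add]
  | hsmul c x hx => rw [map_smul, map_smul, LinearMap.smul_apply, hx, map_smul, smul_neg]
  | hplus w =>
    rw [key, twistForm_VPlus]
    simp only [bilinC_gammaPlus_gammaPlus, bilinC_gammaPlus_gammaMinus, sum_inner_smul_gammaPlus]
    simp
  | hminus w =>
    rw [key, twistForm_VMinus]
    simp only [LinearMap.neg_apply, bilinC_gammaMinus_gammaMinus, bilinC_gammaMinus_gammaPlus,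
      neg_smul, Finset.sum_neg_distrib, sum_inner_smul_gammaMinus]
    simp

theorem gammaForm_mem {M : ℕ} (v : OrthonormalBasis (Fin M) ℂ (VJ J)) :
    gammaForm J v ∈ ⋀[ℂ]^2 (VC V) := by
  refine sum_mem fun m _ => ?_
  rw [ExteriorAlgebra.exteriorPower, pow_two]
  exact Submodule.mul_mem_mul ⟨_, rfl⟩ ⟨_, rfl⟩

theorem neg_gammaForm_pow_mem {M : ℕ} (v : OrthonormalBasis (Fin M) ℂ (VJ J)) (k : ℕ) :
    (-gammaForm J v) ^ k ∈ ⋀[ℂ]^(2 * k) (VC V) := by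
  rw [ExteriorAlgebra.exteriorPower, pow_mul]
  exact Submodule.pow_mem_pow _ (neg_mem (gammaForm_mem v)) k

theorem involute_gammaForm {M : ℕ} (v : OrthonormalBasis (Fin M) ℂ (VJ J)) :
    involute (gammaForm J v) = gammaForm J v := by
  simp [gammaForm, ExteriorAlgebra.ι]

theorem commute_gammaForm {M : ℕ} (v : OrthonormalBasis (Fin M) ℂ (VJ J)) (z : VC V) :
    Commute (ExteriorAlgebra.ι ℂ z) (gammaForm J v) := by
  rw [Commute, SemiconjBy, ExteriorAlgebra.ι_mul_eq_involute_mul_ι, involute_gammaForm]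

theorem projDegree_of_mem {k : ℕ} {x : Ext V} (hx : x ∈ ⋀[ℂ]^k (VC V)) : projDegree k x = x :=
  DirectSum.decompose_of_mem_same (fun i : ℕ => ⋀[ℂ]^i (VC V)) hx

theorem projDegree_of_mem_ne {j k : ℕ} {x : Ext V} (hx : x ∈ ⋀[ℂ]^j (VC V)) (h : j ≠ k) :
    projDegree k x = 0 :=
  DirectSum.decompose_of_mem_ne (fun i : ℕ => ⋀[ℂ]^i (VC V)) hx h

section FiniteDimensional

variable [FiniteDimensional ℝ V]

variable (J) in
theorem finiteDimensional_VJ_and_finrank_VC :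
    FiniteDimensional ℂ (VJ J) ∧ Module.finrank ℂ (VC V) = 2 * Module.finrank ℂ (VJ J) := by
  let e : VJ J ≃ₗ[ℝ] V :=
    { VJ.toV J with
      map_smul' := fun r v => by
        change VJ.toV J ((r : ℂ) • v) = r • VJ.toV J v
        rw [VJ.toV_smul]
        simp }
  have : FiniteDimensional ℝ (VJ J) := FiniteDimensional.of_injective e.toLinearMap e.injective
  refine ⟨Module.Finite.right ℝ ℂ (VJ J), ?_⟩
  rw [Module.finrank_baseChange, ← e.finrank_eq, ← Module.finrank_mul_finrank ℝ ℂ (VJ J),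
    Complex.finrank_real_complex]

theorem finrank_VC {M : ℕ} (v : OrthonormalBasis (Fin M) ℂ (VJ J)) :
    Module.finrank ℂ (VC V) = 2 * M := by
  rw [(finiteDimensional_VJ_and_finrank_VC J).2, Module.finrank_eq_card_basis v.toBasis,
    Fintype.card_fin]

theorem exteriorPower_eq_bot {n : ℕ} (hn : Module.finrank ℂ (VC V) < n) :
    ⋀[ℂ]^n (VC V) = ⊥ := by
  rw [← Submodule.finrank_eq_zero (R := ℂ), exteriorPower.finrank_eq, Nat.choose_eq_zero_of_lt hn]

theorem neg_gammaForm_pow_eq_zero {M : ℕ} (v : OrthonormalBasis (Fin M) ℂ (VJ J)) :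
    (-gammaForm J v) ^ (M + 1) = 0 := by
  have h := neg_gammaForm_pow_mem v (M + 1)
  rwa [exteriorPower_eq_bot (by rw [finrank_VC v]; omega), Submodule.mem_bot] at h

theorem contractLeft_exp {M : ℕ} (v : OrthonormalBasis (Fin M) ℂ (VJ J)) (z : VC V) :
    contractLeft (twistForm J z) (IsNilpotent.exp (-gammaForm J v))
      = ExteriorAlgebra.ι ℂ z * IsNilpotent.exp (-gammaForm J v) := by
  refine IsNilpotent.map_exp_of_map_mul ⟨_, neg_gammaForm_pow_eq_zero v⟩
    (commute_gammaForm v z).neg_right (contractLeft_one (Q := 0) _) fun x => ?_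
  rw [contractLeft_mul, map_neg, map_neg, contractLeft_gammaForm, involute_gammaForm, neg_neg]

theorem contractLeft_mul_exp {M : ℕ} (v : OrthonormalBasis (Fin M) ℂ (VJ J)) (z : VC V)
    (x : Ext V) :
    contractLeft (twistForm J z) (x * IsNilpotent.exp (-gammaForm J v))
      = (contractLeft (twistForm J z) x + ExteriorAlgebra.ι ℂ z * x)
        * IsNilpotent.exp (-gammaForm J v) := by
  rw [contractLeft_mul, contractLeft_exp, add_mul,
    ExteriorAlgebra.ι_mul_eq_involute_mul_ι z x, mul_assoc (involute x)]

/-- The component of `e^{-γ}` in the top degree is `ω`. -/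
theorem projDegree_exp {M : ℕ} (v : OrthonormalBasis (Fin M) ℂ (VJ J)) :
    projDegree (2 * M) (IsNilpotent.exp (-gammaForm J v)) = omegaForm J v := by
  rw [IsNilpotent.exp_eq_sum (neg_gammaForm_pow_eq_zero v), map_sum, Finset.sum_range_succ,
    Finset.sum_eq_zero, zero_add, map_rat_smul,
    projDegree_of_mem (neg_gammaForm_pow_mem v M), omegaForm,
    ← Rat.cast_smul_eq_qsmul ℂ]
  · simp
  · intro k hk
    have hk := Finset.mem_range.1 hk
    rw [map_rat_smul, projDegree_of_mem_ne (neg_gammaForm_pow_mem v k) (by omega), smul_zero]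

/-- If `ω` were zero, then so would be `x ↦ P (x ∧ e^{-γ})`, hence `P` itself, as `e^{-γ}` is
invertible. -/
theorem omegaForm_ne_zero_of {M : ℕ} (v : OrthonormalBasis (Fin M) ℂ (VJ J)) {E : Ext V →ₗ[ℂ] ℂ}
    (hE : ∀ x, projDegree (2 * M) (x * IsNilpotent.exp (-gammaForm J v)) = E x • omegaForm J v) :
    omegaForm J v ≠ 0 := by
  intro h0
  have h : ⋀[ℂ]^(2 * M) (VC V) = ⊥ := by
    refine eq_bot_iff.2 fun x hx => ?_
    have h1 := hE (x * IsNilpotent.exp (gammaForm J v))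
    have hg : IsNilpotent (gammaForm J v) := isNilpotent_neg_iff.1 ⟨_, neg_gammaForm_pow_eq_zero v⟩
    rw [mul_assoc, IsNilpotent.exp_mul_exp_neg_self hg, mul_one, h0, smul_zero,
      projDegree_of_mem hx] at h1
    exact h1
  rw [← Submodule.finrank_eq_zero (R := ℂ), exteriorPower.finrank_eq, finrank_VC v,
    Nat.choose_self] at h
  exact one_ne_zero h

theorem projDegree_ι_mul_mul_exp {M : ℕ} (v : OrthonormalBasis (Fin M) ℂ (VJ J)) (z : VC V)
    (x : Ext V) :
    projDegree (2 * M) (ExteriorAlgebra.ι ℂ z * x * IsNilpotent.exp (-gammaForm J v))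
      = -projDegree (2 * M)
          (contractLeft (twistForm J z) x * IsNilpotent.exp (-gammaForm J v)) := by
  have h : projDegree (2 * M)
      (contractLeft (twistForm J z) (x * IsNilpotent.exp (-gammaForm J v))) = 0 :=
    ExteriorAlgebra.proj_contractLeft_eq_zero _
      (exteriorPower_eq_bot (by rw [finrank_VC v]; omega)) _
  rw [contractLeft_mul_exp, add_mul, map_add] at h
  exact eq_neg_of_add_eq_zero_right h

/-- For every trace `τ`, both `ζ ↦ P (ζ ∧ e^{-γ})` and `τ ∘ ν` satisfy the recursion
`f (z ∧ x) = -f (A(z) ⌋ x)`, where `A` is `twistForm J`. -/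
theorem IsCliffordTrace.isBerezinExpectation {τ : Cl V →ₗ[ℂ] ℂ} (hτ : IsCliffordTrace τ) :
    IsBerezinExpectation J (τ ∘ₗ (normalOrdering J).toLinearMap) := by
  intro M v
  refine LinearMap.congr_fun (f := projDegree (2 * M) ∘ₗ
    LinearMap.mulRight ℂ (IsNilpotent.exp (-gammaForm J v)))
    (g := (τ ∘ₗ (normalOrdering J).toLinearMap).smulRight (omegaForm J v)) ?_
  refine ExteriorAlgebra.linearMap_ext_contractLeft (toQuadraticMap_twistForm J) ?_
    (fun z x => ?_) fun z x => ?_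
  · simp [projDegree_exp, normalOrdering_one, hτ.map_one]
  · exact projDegree_ι_mul_mul_exp v z x
  · simp [normalOrdering_ι_mul, normalOrdering_contractLeft, hτ.map_ι_mul]

variable (J) in
theorem IsBerezinExpectation.unique {E E' : Ext V →ₗ[ℂ] ℂ} (h : IsBerezinExpectation J E)
    (h' : IsBerezinExpectation J E') : E = E' := by
  have := (finiteDimensional_VJ_and_finrank_VC J).1
  let v := stdOrthonormalBasis ℂ (VJ J)
  refine LinearMap.ext fun x => ?_
  exact smul_left_injective ℂ (omegaForm_ne_zero_of v (h _ v))
    ((h _ v x).symm.trans (h' _ v x))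

end FiniteDimensional

end BerezinClifford

end

theorem theorem4 {V : Type*} [NormedAddCommGroup V] [InnerProductSpace ℝ V]
    [FiniteDimensional ℝ V] (J : BerezinClifford.OrthogonalComplexStructure V) :
    (∃! E : BerezinClifford.Ext V →ₗ[ℂ] ℂ, BerezinClifford.IsBerezinExpectation J E) ∧
    (∃! τ : BerezinClifford.Cl V →ₗ[ℂ] ℂ, BerezinClifford.IsCliffordTrace τ) ∧
    (∃! ν : BerezinClifford.Ext V ≃ₗ[ℂ] BerezinClifford.Cl V, BerezinClifford.IsOrdering J ν) ∧
    ∀ (E : BerezinClifford.Ext V →ₗ[ℂ] ℂ) (τ : BerezinClifford.Cl V →ₗ[ℂ] ℂ)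
      (ν : BerezinClifford.Ext V ≃ₗ[ℂ] BerezinClifford.Cl V),
      BerezinClifford.IsBerezinExpectation J E → BerezinClifford.IsCliffordTrace τ →
      BerezinClifford.IsOrdering J ν → E = τ ∘ₗ ν.toLinearMap := by
  open BerezinClifford in
  refine ⟨⟨_, isCliffordTrace_cliffordTrace.isBerezinExpectation, fun E hE =>
      hE.unique J isCliffordTrace_cliffordTrace.isBerezinExpectation⟩,
    ⟨_, isCliffordTrace_cliffordTrace, fun τ hτ => hτ.unique isCliffordTrace_cliffordTrace⟩,
    ⟨_, isOrdering_normalOrdering J, fun ν hν => hν.unique J (isOrdering_normalOrdering J)⟩,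
    fun E τ ν hE hτ hν => ?_⟩
  rw [BerezinClifford.IsOrdering.unique J hν (BerezinClifford.isOrdering_normalOrdering J)]
  exact hE.unique J hτ.isBerezinExpectation
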